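/- Let $\mathcal M$ be a (finite-dimensional, smooth) Riemannian manifold with geodesic distance $d$, and let $\mathcal X\subset\mathcal M$ be compact and geodesically convex: any two points $x,y\in\mathcal X$ are joined by exactly one minimizing geodesic $\gamma_{x,y}:[0,1]\to\mathcal M$ of constant speed with $\gamma_{x,y}(0)=x$, $\gamma_{x,y}(1)=y$ that is contained in $\mathcal X$. Write $\mathrm{Exp}_x^{-1}(y):=\dot\gamma_{x,y}(0)\in T_x\mathcal M$ for $x,y\in\mathcal X$. Let $\mathcal P$ be a probability measure on a measurable space $\Xi$, and let $\Phi(x)=\mathbb E_{\xi\sim\mathcal P}[\phi(x,\xi)]$ for $x\in\mathcal M$, where $\phi(x,\cdot)$ is $\mathcal P$-integrable. Assume: 1. for every $x\in\mathcal X$ and almost every $\xi$, $\phi(\cdot,\xi)$ is differentiable at $x$; the stochastic gradient is measurable in $(x,\xi)\in\mathcal X\times\Xi$ and unbiased, $\mathbb E_\xi[\mathrm{grad}\,\phi(x,\xi)]=\mathrm{grad}\,\Phi(x)$ for all $x\in\mathcal X$; and there is a constant $C$ such that, for all $x\in\mathcal X$, $\|\mathrm{grad}\,\phi(x,\xi)\|\le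 C$ for almost every $\xi$; 2. $\Phi$ is $L$-smooth on $\mathcal X$: it is differentiable at every point of $\mathcal X$ and $\Phi(y)\le\Phi(x)+\langle\mathrm{grad}\,\Phi(x),\mathrm{Exp}_x^{-1}(y)\rangle_x+\frac L2 d(x,y)^2$ for all $x,y\in\mathcal X$; 3. $\Phi$ is geodesically convex on $\mathcal X$: $\Phi(y)\ge\Phi(x)+\langle\mathrm{grad}\,\Phi(x),\mathrm{Exp}_x^{-1}(y)\rangle_x$ for all $x,y\in\mathcal X$. Let $x^*\in\mathcal X$ be a minimizer of $\Phi$ over $\mathcal X$ and let $x_0\in\mathcal X$. For $K\ge1$, the stochastic Riemannian Frank-Wolfe method (SRFW) with $K$ iterations, constant step size $\eta_k=1/\sqrt K$ and constant batch size $b_k=K$ does the following for $k=0,\dots,K-1$: draw i.i.d. samples $\xi_{k,1},\dots,\xi_{k,K}\sim\mathcal P$, independent of the past; choose (measurably, with ties broken in any way) $$y_k\in\operatorname*{argmin}_{y\in\mathcal X}\Big\langle\tfrac1K\sum_{i=1}^K\mathrm{grad}\,\phi(x_k,\xi_{k,i}),\ \mathrm{Exp}_{x_k}^{-1}(y)\Big\rangle_{x_k};$$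 and set $x_{k+1}=\gamma_{x_k,y_k}(\eta_k)$. Its output $\hat x$ is chosen uniformly at random from $x_0,\dots,x_{K-1}$, independently of the run. Then the expected optimality gap is $O(1/\sqrt K)$: there is a constant $A$, depending on the problem and on $x_0$ but not on $K$ or on the run, such that for every $K\ge1$ and every such run $\Phi(\hat x)-\Phi(x^*)$ is integrable and $$0\le\mathbb E\big[\Phi(\hat x)-\Phi(x^*)\big]\le\frac{A}{\sqrt K}.$$ -/

import Mathlib

open Bundle Set MeasureTheory ProbabilityTheory
open scoped Manifold ContDiff

noncomputable section

namespace RiemannianFW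

section Geometry

variable (E : Type*) [NormedAddCommGroup E] [NormedSpace ℝ E] [FiniteDimensional ℝ E]
  {M : Type*} [EMetricSpace M] [ChartedSpace E M]
  [RiemannianBundle (fun x : M ↦ TangentSpace 𝓘(ℝ, E) x)]

/-- The geodesic distance as a real number. It is used only between points that are joined by a
smooth curve, where the extended distance is finite. -/
def gdist (x y : M) : ℝ := (edist x y).toReal

/-- The Riemannian gradient of `f` at `x`: the Riesz representative, for the inner product of
`T_x M`, of the differential of `f` at `x` (see `inner_grad`). -/
def grad (f : M → ℝ) (x : M) : TangentSpace 𝓘(ℝ, E) x :=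
  haveI : FiniteDimensional ℝ (TangentSpace 𝓘(ℝ, E) x) :=
    inferInstanceAs (FiniteDimensional ℝ E)
  haveI : CompleteSpace (TangentSpace 𝓘(ℝ, E) x) :=
    FiniteDimensional.complete ℝ (TangentSpace 𝓘(ℝ, E) x)
  (InnerProductSpace.toDual ℝ (TangentSpace 𝓘(ℝ, E) x)).symm (mfderiv 𝓘(ℝ, E) 𝓘(ℝ, ℝ) f x)

/-- The defining property of the gradient. -/
theorem inner_grad (f : M → ℝ) (x : M) (v : TangentSpace 𝓘(ℝ, E) x) :
    inner ℝ (grad E f x) v = (mfderiv 𝓘(ℝ, E) 𝓘(ℝ, ℝ) f x v : ℝ) := by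
  have : FiniteDimensional ℝ (TangentSpace 𝓘(ℝ, E) x) :=
    inferInstanceAs (FiniteDimensional ℝ E)
  have : CompleteSpace (TangentSpace 𝓘(ℝ, E) x) :=
    FiniteDimensional.complete ℝ (TangentSpace 𝓘(ℝ, E) x)
  exact InnerProductSpace.toDual_symm_apply

/-- `γ`, restricted to `[0, 1]`, is a minimizing geodesic from `x` to `y`: a smooth curve of
constant speed `d(x, y)`, so that its length is the distance of its end points. -/
def IsMinGeodesic (γ : ℝ → M) (x y : M) : Prop :=
  γ 0 = x ∧ γ 1 = y ∧ ContMDiffOn 𝓘(ℝ, ℝ) 𝓘(ℝ, E) ∞ γ (Icc 0 1) ∧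
    ∀ t ∈ Icc (0 : ℝ) 1,
      ‖mfderivWithin 𝓘(ℝ, ℝ) 𝓘(ℝ, E) γ (Icc 0 1) t (1 : ℝ)‖ₑ = edist x y

/-- `γ`, restricted to `[0, 1]`, is a minimizing geodesic from `x` to `y` that stays in `X`. -/
def IsMinGeodesicIn (X : Set M) (γ : ℝ → M) (x y : M) : Prop :=
  IsMinGeodesic E γ x y ∧ MapsTo γ (Icc 0 1) X

/-- `X` is geodesically convex: any two of its points are joined by exactly one minimizing
geodesic in `X`. -/
def GeodesicallyConvex (X : Set M) : Prop :=
  ∀ x ∈ X, ∀ y ∈ X, (∃ γ : ℝ → M, IsMinGeodesicIn E X γ x y) ∧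
    ∀ γ γ' : ℝ → M, IsMinGeodesicIn E X γ x y → IsMinGeodesicIn E X γ' x y →
      EqOn γ γ' (Icc 0 1)

/-- The geodesic map `γ : [0, 1] → X` with `γ 0 = x` and `γ 1 = y`, for points `x`, `y` of a
geodesically convex set `X`. -/
def geodesicMap (X : Set M) (x y : M) : ℝ → M :=
  @Classical.epsilon (ℝ → M) ⟨fun _ ↦ x⟩ fun γ ↦ IsMinGeodesicIn E X γ x y

/-- `v` is the initial velocity of a minimizing geodesic in `X` from `x` to `y`; that is,
`Exp_x v = y` along that geodesic. -/
def IsInvExp (X : Set M) (x y : M) (v : TangentSpace 𝓘(ℝ, E) x) : Prop :=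
  ∃ γ : ℝ → M, IsMinGeodesicIn E X γ x y ∧
    tangentMapWithin 𝓘(ℝ, ℝ) 𝓘(ℝ, E) γ (Icc 0 1)
      (⟨0, (1 : ℝ)⟩ : TangentBundle 𝓘(ℝ, ℝ) ℝ) = (⟨x, v⟩ : TangentBundle 𝓘(ℝ, E) M)

/-- The inverse exponential map `Exp_x⁻¹ y`, for points `x`, `y` of a geodesically convex
set `X`. -/
def invExp (X : Set M) (x y : M) : TangentSpace 𝓘(ℝ, E) x :=
  Classical.epsilon fun v ↦ IsInvExp E X x y v

/-- `f` is `L`-smooth on `X`. -/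
def LSmoothOn (L : ℝ) (X : Set M) (f : M → ℝ) : Prop :=
  (∀ x ∈ X, MDifferentiableAt 𝓘(ℝ, E) 𝓘(ℝ, ℝ) f x) ∧
    ∀ x ∈ X, ∀ y ∈ X,
      f y ≤ f x + inner ℝ (grad E f x) (invExp E X x y) + L / 2 * gdist x y ^ 2

/-- `f` is geodesically convex on `X`. -/
def GConvexOn (X : Set M) (f : M → ℝ) : Prop :=
  ∀ x ∈ X, ∀ y ∈ X, f x + inner ℝ (grad E f x) (invExp E X x y) ≤ f y

variable {Ξ : Type*} [MeasurableSpace Ξ]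

/-- The minibatch gradient `(1/b) ∑ i, grad φ(x, ξ i)`. -/
def batchGrad (φ : M → Ξ → ℝ) {b : ℕ} (x : M) (ξ : Fin b → Ξ) : TangentSpace 𝓘(ℝ, E) x :=
  (1 / (b : ℝ)) • ∑ i, grad E (fun z ↦ φ z (ξ i)) x

/-- A run of stochastic Riemannian Frank-Wolfe with `K` iterations, batch sizes `b k`, step sizes
`η k` and initial point `x₀`, on the probability space `(Ω, μ)`. The σ-algebra `ℱ k` is the history
before the samples `ξ k 0, …, ξ k (b k - 1)` of iteration `k` are drawn; `x k` and `y k` are the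
iterates and the answers of the linear oracle; `κ` is the random index of the output `x κ`. -/
structure IsSRFWRun (X : Set M) (φ : M → Ξ → ℝ) (P : Measure Ξ) (x₀ : M) (K : ℕ) (b : ℕ → ℕ)
    (η : ℕ → ℝ) [MeasurableSpace M] {Ω : Type*} [mΩ : MeasurableSpace Ω] (μ : Measure Ω)
    (ℱ : Filtration ℕ mΩ) (ξ : ∀ k : ℕ, Fin (b k) → Ω → Ξ) (x y : ℕ → Ω → M)
    (κ : Ω → Fin K) : Prop where
  init : ∀ w, x 0 w = x₀
  adapted_x : ∀ k ≤ K, Measurable[ℱ k] (x k)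
  adapted_y : ∀ k < K, Measurable[ℱ (k + 1)] (y k)
  adapted_sample : ∀ k < K, ∀ i, Measurable[ℱ (k + 1)] (ξ k i)
  /-- The samples have law `P`. -/
  law_sample : ∀ k < K, ∀ i, μ.map (ξ k i) = P
  /-- The samples of one batch are independent of each other … -/
  indep_sample : ∀ k < K, iIndepFun (ξ k) μ
  /-- … and, together, of the history before they are drawn. -/
  indep_history : ∀ k < K,
    Indep (MeasurableSpace.comap (fun w i ↦ ξ k i w) MeasurableSpace.pi) (ℱ k) μ
  oracle_mem : ∀ k < K, ∀ w, y k w ∈ X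
  /-- `y k` is a minimizer over `X` of the linearized objective. -/
  oracle_min : ∀ k < K, ∀ w,
    IsMinOn (fun z ↦ inner ℝ (batchGrad E φ (x k w) fun i ↦ ξ k i w) (invExp E X (x k w) z))
      X (y k w)
  step : ∀ k < K, ∀ w, x (k + 1) w = geodesicMap E X (x k w) (y k w) (η k)
  measurable_index : Measurable κ
  /-- The output index is uniform on `{0, …, K - 1}` … -/
  uniform_index : ∀ j : Fin K, μ (κ ⁻¹' {j}) = (K : ENNReal)⁻¹
  /-- … and independent of the run. -/
  indep_index : Indep (MeasurableSpace.comap κ ⊤) (ℱ K) μ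

end Geometry

end RiemannianFW

end

/-! The argument is the Frank-Wolfe descent inequality with an inexact gradient. By uniqueness of
geodesics, `Exp_x⁻¹` of the point at time `η` on the geodesic from `x` to `y` is `η • Exp_x⁻¹ y`
(`invExp_geodesicMap`), so smoothness bounds the new value through `⟨grad Φ x, Exp_x⁻¹ y⟩`. The
oracle minimizes this pairing with the batch gradient `v` in place of `grad Φ x`. Comparing `y` with
a minimizer `z` and using convexity gives at most `Φ z - Φ x + 2 D r`, where `r = ‖v - grad Φ x‖`
and `D` bounds the diameter of `X`. By `2 η r ≤ η² + r²`, only `r²` has to be controlled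
(`frankWolfe_step`).

A batch of `K` independent, unbiased, bounded gradients has mean squared error at most `C² / K`;
independence from the past carries this over to the random iterate (`lintegral_batchGrad_error_le`).
With `η² = 1 / K`, the errors of all `K` steps add up to a constant while the function values
telescope. The sum of the expected gaps is therefore `O(√K)`, and a uniform index averages it to
`O(1 / √K)`. -/

namespace RiemannianFW

/-! ### Minimizing geodesics and the inverse exponential map -/

section MinGeodesic

variable {E : Type*} [NormedAddCommGroup E] [NormedSpace ℝ E]
  {M : Type*} [EMetricSpace M] [ChartedSpace E M]
  [RiemannianBundle (fun x : M ↦ TangentSpace 𝓘(ℝ, E) x)]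
  {X : Set M} {γ : ℝ → M} {x y : M}

theorem IsMinGeodesic.edist_lt_top (h : IsMinGeodesic E γ x y) : edist x y < ⊤ := by
  rw [← h.2.2.2 0 (by simp)]
  exact enorm_lt_top

theorem IsMinGeodesic.edist_le [IsManifold 𝓘(ℝ, E) ∞ M] [IsRiemannianManifold 𝓘(ℝ, E) M]
    (h : IsMinGeodesic E γ x y) {a b : ℝ} (ha : 0 ≤ a) (hab : a ≤ b) (hb : b ≤ 1) :
    edist (γ a) (γ b) ≤ edist x y * ENNReal.ofReal (b - a) := by
  rw [IsRiemannianManifold.out (I := 𝓘(ℝ, E)) (γ a) (γ b)]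
  have hs : Icc a b ⊆ Icc 0 1 := Icc_subset_Icc ha hb
  have hγ : ContMDiffOn 𝓘(ℝ, ℝ) 𝓘(ℝ, E) 1 γ (Icc a b) :=
    (h.2.2.1.mono hs).of_le (by exact_mod_cast le_top)
  refine (Manifold.riemannianEDist_le_pathELength hγ rfl rfl hab).trans ?_
  rw [Manifold.pathELength_eq_lintegral_mfderiv_Ioo,
    setLIntegral_congr_fun (g := fun _ ↦ edist x y) measurableSet_Ioo]
  · simp
  · intro t ht
    have ht' : Icc (0 : ℝ) 1 ∈ nhds t :=
      Icc_mem_nhds (ha.trans_lt ht.1) (ht.2.trans_le hb)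
    have := h.2.2.2 t (mem_of_mem_nhds ht')
    rwa [mfderivWithin_of_mem_nhds ht'] at this

/-- Arc length bounds the distances across the two pieces by amounts that add up to `d(x, y)`, so
the triangle inequality leaves no slack in either. -/
theorem IsMinGeodesic.edist_left [IsManifold 𝓘(ℝ, E) ∞ M] [IsRiemannianManifold 𝓘(ℝ, E) M]
    (h : IsMinGeodesic E γ x y) {s : ℝ} (hs : s ∈ Icc (0 : ℝ) 1) :
    edist x (γ s) = edist x y * ENNReal.ofReal s := by
  have h1 := h.edist_le le_rfl hs.1 hs.2
  have h2 := h.edist_le hs.1 hs.2 le_rfl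
  rw [h.1, sub_zero] at h1
  rw [h.2.1] at h2
  refine le_antisymm h1 ?_
  have hfin : edist x y * ENNReal.ofReal (1 - s) ≠ ⊤ :=
    ENNReal.mul_ne_top h.edist_lt_top.ne ENNReal.ofReal_ne_top
  rw [← ENNReal.add_le_add_iff_right hfin, ← mul_add,
    ← ENNReal.ofReal_add hs.1 (sub_nonneg.2 hs.2)]
  simpa using (edist_triangle x (γ s) y).trans (add_le_add_right h2 _)

theorem IsMinGeodesic.mfderivWithin_comp_mul (h : IsMinGeodesic E γ x y) {s t : ℝ}
    (hs : s ∈ Icc (0 : ℝ) 1) (ht : t ∈ Icc (0 : ℝ) 1) :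
    mfderivWithin 𝓘(ℝ, ℝ) 𝓘(ℝ, E) (fun u ↦ γ (s * u)) (Icc 0 1) t (1 : ℝ) =
      s • mfderivWithin 𝓘(ℝ, ℝ) 𝓘(ℝ, E) γ (Icc 0 1) (s * t) (1 : ℝ) := by
  have hst : s * t ∈ Icc (0 : ℝ) 1 :=
    ⟨mul_nonneg hs.1 ht.1, mul_le_one₀ hs.2 ht.1 ht.2⟩
  have h1 : HasMFDerivWithinAt 𝓘(ℝ, ℝ) 𝓘(ℝ, E) γ (Icc 0 1) (s * t)
      (mfderivWithin 𝓘(ℝ, ℝ) 𝓘(ℝ, E) γ (Icc 0 1) (s * t)) :=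
    ((h.2.2.1 _ hst).mdifferentiableWithinAt (by simp)).hasMFDerivWithinAt
  have h2 : HasMFDerivWithinAt 𝓘(ℝ, ℝ) 𝓘(ℝ, ℝ) (fun u : ℝ ↦ s * u) (Icc 0 1) t
      (s • ContinuousLinearMap.id ℝ ℝ) :=
    ((hasFDerivAt_id t).const_mul s).hasFDerivWithinAt.hasMFDerivWithinAt
  have h3 := HasMFDerivWithinAt.comp (I' := 𝓘(ℝ, ℝ)) t h1 h2 (fun u hu ↦
    ⟨mul_nonneg hs.1 hu.1, mul_le_one₀ hs.2 hu.1 hu.2⟩)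
  have h4 := h3.mfderivWithin (uniqueMDiffOn_iff_uniqueDiffOn.2 uniqueDiffOn_Icc_zero_one t ht)
  have h5 := congrArg (fun A ↦ A (1 : ℝ)) h4
  refine h5.trans ?_
  -- All tangent spaces unfold to `E`, so homogeneity is stated for plain linear maps.
  have h6 : ∀ A : ℝ →L[ℝ] E, A (s * 1) = s • A 1 := fun A ↦ A.map_smul s 1
  exact h6 _

theorem IsMinGeodesicIn.comp_mul [IsManifold 𝓘(ℝ, E) ∞ M] [IsRiemannianManifold 𝓘(ℝ, E) M]
    (h : IsMinGeodesicIn E X γ x y) {s : ℝ} (hs : s ∈ Icc (0 : ℝ) 1) :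
    IsMinGeodesicIn E X (fun u ↦ γ (s * u)) x (γ s) := by
  have hst : ∀ t ∈ Icc (0 : ℝ) 1, s * t ∈ Icc (0 : ℝ) 1 := fun t ht ↦
    ⟨mul_nonneg hs.1 ht.1, mul_le_one₀ hs.2 ht.1 ht.2⟩
  refine ⟨⟨by simp [h.1.1], by simp, ?_, fun t ht ↦ ?_⟩, fun t ht ↦ h.2 (hst t ht)⟩
  · exact h.1.2.2.1.comp (I' := 𝓘(ℝ, ℝ))
      (contDiff_const.mul contDiff_id).contMDiff.contMDiffOn hst
  · rw [h.1.mfderivWithin_comp_mul hs ht, enorm_smul, h.1.2.2.2 _ (hst t ht),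
      h.1.edist_left hs, mul_comm, Real.enorm_of_nonneg hs.1]

/-- Geodesics that agree on `[0, 1]` have the same one-sided derivative at `0`. Comparing in the
total space avoids transporting vectors between fibres. -/
theorem IsInvExp.unique (hX : GeodesicallyConvex E X) (hx : x ∈ X) (hy : y ∈ X)
    {v w : TangentSpace 𝓘(ℝ, E) x} (hv : IsInvExp E X x y v) (hw : IsInvExp E X x y w) :
    v = w := by
  obtain ⟨γ, hγ, h1⟩ := hv
  obtain ⟨γ', hγ', h2⟩ := hw
  have := (hX x hx y hy).2 γ γ' hγ hγ'
  have h3 := tangentMapWithin_congr (I := 𝓘(ℝ, ℝ)) (I' := 𝓘(ℝ, E)) this ⟨0, (1 : ℝ)⟩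
    (by simp)
  rw [h1, h2] at h3
  simpa using h3

theorem IsMinGeodesicIn.isInvExp (h : IsMinGeodesicIn E X γ (γ 0) y) :
    IsInvExp E X (γ 0) y (mfderivWithin 𝓘(ℝ, ℝ) 𝓘(ℝ, E) γ (Icc 0 1) 0 (1 : ℝ)) :=
  ⟨γ, h, rfl⟩

theorem geodesicMap_spec (hX : GeodesicallyConvex E X) (hx : x ∈ X) (hy : y ∈ X) :
    IsMinGeodesicIn E X (geodesicMap E X x y) x y :=
  Classical.epsilon_spec_aux _ _ (hX x hx y hy).1

theorem IsInvExp.invExp_eq (hX : GeodesicallyConvex E X) (hx : x ∈ X) (hy : y ∈ X)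
    {v : TangentSpace 𝓘(ℝ, E) x} (hv : IsInvExp E X x y v) : invExp E X x y = v :=
  (Classical.epsilon_spec ⟨v, hv⟩ : IsInvExp E X x y (invExp E X x y)).unique hX hx hy hv

theorem enorm_invExp (hX : GeodesicallyConvex E X) (hx : x ∈ X) (hy : y ∈ X) :
    ‖invExp E X x y‖ₑ = edist x y := by
  obtain ⟨γ, h⟩ := (hX x hx y hy).1
  obtain rfl := h.1.1
  rw [h.isInvExp.invExp_eq hX hx hy, h.1.2.2.2 0 (by simp)]

theorem norm_invExp (hX : GeodesicallyConvex E X) (hx : x ∈ X) (hy : y ∈ X) :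
    ‖invExp E X x y‖ = gdist x y := by
  rw [gdist, ← enorm_invExp hX hx hy, toReal_enorm]

theorem invExp_geodesicMap [IsManifold 𝓘(ℝ, E) ∞ M] [IsRiemannianManifold 𝓘(ℝ, E) M]
    (hX : GeodesicallyConvex E X) (hx : x ∈ X) (hy : y ∈ X) {s : ℝ} (hs : s ∈ Icc (0 : ℝ) 1) :
    invExp E X x (geodesicMap E X x y s) = s • invExp E X x y := by
  have h := geodesicMap_spec (E := E) hX hx hy
  -- Once the curve is a variable, `x` can be replaced by `γ 0` and all velocities lie in one fibre.
  generalize geodesicMap E X x y = γ at h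
  obtain rfl := h.1.1
  have h' := h.comp_mul hs
  have hv : IsInvExp E X (γ 0) (γ s)
      (s • mfderivWithin 𝓘(ℝ, ℝ) 𝓘(ℝ, E) γ (Icc 0 1) 0 (1 : ℝ) : TangentSpace 𝓘(ℝ, E) (γ 0)) := by
    refine ⟨_, h', ?_⟩
    have := h.1.mfderivWithin_comp_mul hs (t := 0) (by simp)
    simp only [tangentMapWithin]
    rw [this]
    simp only [TotalSpace.mk.injEq]
    rw [mul_zero]
    exact ⟨rfl, HEq.rfl⟩
  rw [hv.invExp_eq hX hx (h.2 hs), h.isInvExp.invExp_eq hX hx hy]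

theorem gdist_geodesicMap [IsManifold 𝓘(ℝ, E) ∞ M] [IsRiemannianManifold 𝓘(ℝ, E) M]
    (hX : GeodesicallyConvex E X) (hx : x ∈ X) (hy : y ∈ X) {s : ℝ} (hs : s ∈ Icc (0 : ℝ) 1) :
    gdist x (geodesicMap E X x y s) = s * gdist x y := by
  rw [gdist, (geodesicMap_spec hX hx hy).1.edist_left hs, ENNReal.toReal_mul,
    ENNReal.toReal_ofReal hs.1, mul_comm, gdist]

/-- The extended distance attains its maximum on `X ×ˢ X`, at a pair joined by a geodesic; hence the
maximum is finite. -/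
theorem exists_gdist_le (hXc : IsCompact X) (hX : GeodesicallyConvex E X) :
    ∃ D : ℝ, 0 ≤ D ∧ ∀ x ∈ X, ∀ y ∈ X, gdist x y ≤ D := by
  rcases X.eq_empty_or_nonempty with rfl | hne
  · exact ⟨0, le_rfl, by simp⟩
  obtain ⟨p, hp, hmax⟩ := (hXc.prod hXc).exists_isMaxOn (hne.prod hne)
    (continuous_edist (α := M)).continuousOn
  obtain ⟨γ, hγ⟩ := (hX p.1 hp.1 p.2 hp.2).1
  exact ⟨gdist p.1 p.2, ENNReal.toReal_nonneg, fun x hx y hy ↦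
    ENNReal.toReal_mono hγ.1.edist_lt_top.ne (hmax (mk_mem_prod hx hy))⟩

end MinGeodesic

/-! ### Measurability of sections of the tangent bundle -/

section Measurability

variable {E : Type*} [NormedAddCommGroup E] [NormedSpace ℝ E] [FiniteDimensional ℝ E]
  {M : Type*} [EMetricSpace M] [SecondCountableTopology M] [MeasurableSpace M] [BorelSpace M]
  [ChartedSpace E M] [IsManifold 𝓘(ℝ, E) ∞ M]
  [RiemannianBundle (fun x : M ↦ TangentSpace 𝓘(ℝ, E) x)]
  {α : Type*} [MeasurableSpace α] {p : α → M}

omit [FiniteDimensional ℝ E] [RiemannianBundle (fun x : M ↦ TangentSpace 𝓘(ℝ, E) x)] in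
-- Second countability reduces measurability to countably many trivializing charts.
theorem measurable_of_forall_trivializationAt {β : Type*} [MeasurableSpace β] (hp : Measurable p)
    (f : α → β)
    (hf : ∀ x : M, Measurable fun a : p ⁻¹' (trivializationAt E (TangentSpace 𝓘(ℝ, E)) x).baseSet ↦
      f a) : Measurable f := by
  obtain ⟨s, hsc, hs⟩ := TopologicalSpace.countable_cover_nhds (α := M)
    (f := fun x ↦ (trivializationAt E (TangentSpace 𝓘(ℝ, E)) x).baseSet)
    fun x ↦ (trivializationAt E (TangentSpace 𝓘(ℝ, E)) x).open_baseSet.mem_nhds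
      (FiberBundle.mem_baseSet_trivializationAt' x)
  intro t ht
  have h : f ⁻¹' t = ⋃ x ∈ s, f ⁻¹' t ∩
      p ⁻¹' (trivializationAt E (TangentSpace 𝓘(ℝ, E)) x).baseSet := by
    rw [← inter_iUnion₂, ← preimage_iUnion₂, hs, preimage_univ, inter_univ]
  rw [h]
  refine MeasurableSet.biUnion hsc fun x _ ↦ ?_
  have h2 := (MeasurableEmbedding.subtype_coe (hp
    (trivializationAt E (TangentSpace 𝓘(ℝ, E)) x).open_baseSet.measurableSet)).measurableSet_image.2
    (hf x ht)
  convert h2 using 1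
  ext a
  simp [and_comm]

omit [FiniteDimensional ℝ E] [RiemannianBundle (fun x : M ↦ TangentSpace 𝓘(ℝ, E) x)]
  [SecondCountableTopology M] in
theorem measurable_base_of_section {v : ∀ a, TangentSpace 𝓘(ℝ, E) (p a)}
    (hv : Measurable[inferInstance, borel (TangentBundle 𝓘(ℝ, E) M)]
      (fun a ↦ (⟨p a, v a⟩ : TangentBundle 𝓘(ℝ, E) M))) : Measurable p := by
  let _ : MeasurableSpace (TangentBundle 𝓘(ℝ, E) M) := borel _
  have : BorelSpace (TangentBundle 𝓘(ℝ, E) M) := ⟨rfl⟩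
  exact (FiberBundle.continuous_proj E (TangentSpace 𝓘(ℝ, E) (M := M))).measurable.comp hv

omit [FiniteDimensional ℝ E] [RiemannianBundle (fun x : M ↦ TangentSpace 𝓘(ℝ, E) x)]
  [SecondCountableTopology M] [MeasurableSpace M] [BorelSpace M] in
theorem measurable_trivialization_snd [MeasurableSpace E] [BorelSpace E]
    {v : ∀ a, TangentSpace 𝓘(ℝ, E) (p a)}
    (hv : Measurable[inferInstance, borel (TangentBundle 𝓘(ℝ, E) M)]
      (fun a ↦ (⟨p a, v a⟩ : TangentBundle 𝓘(ℝ, E) M)))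
    (e : Trivialization E (π E (TangentSpace 𝓘(ℝ, E) (M := M)))) :
    Measurable fun a : p ⁻¹' e.baseSet ↦ (e ⟨p a, v a⟩).2 := by
  let _ : MeasurableSpace (TangentBundle 𝓘(ℝ, E) M) := borel _
  have : BorelSpace (TangentBundle 𝓘(ℝ, E) M) := ⟨rfl⟩
  have h1 : Measurable fun a : p ⁻¹' e.baseSet ↦
      (⟨⟨p a, v a⟩, e.mem_source.2 a.2⟩ : e.source) :=
    (hv.comp measurable_subtype_coe).subtype_mk
  have h2 : Continuous fun z : e.source ↦ (e z).2 :=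
    continuous_snd.comp (continuousOn_iff_continuous_domRestrict.1 e.continuousOn)
  exact h2.measurable.comp h1

/-- In a trivialization the metric is a continuous function of the base point and of two coordinate
vectors, each of which depends measurably on the parameter. -/
theorem measurable_inner_section
    [IsContMDiffRiemannianBundle 𝓘(ℝ, E) ∞ E (fun x : M ↦ TangentSpace 𝓘(ℝ, E) x)]
    {v w : ∀ a, TangentSpace 𝓘(ℝ, E) (p a)}
    (hv : Measurable[inferInstance, borel (TangentBundle 𝓘(ℝ, E) M)]
      (fun a ↦ (⟨p a, v a⟩ : TangentBundle 𝓘(ℝ, E) M)))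
    (hw : Measurable[inferInstance, borel (TangentBundle 𝓘(ℝ, E) M)]
      (fun a ↦ (⟨p a, w a⟩ : TangentBundle 𝓘(ℝ, E) M))) :
    Measurable fun a ↦ (inner ℝ (v a) (w a) : ℝ) := by
  let _ : MeasurableSpace E := borel E
  have : BorelSpace E := ⟨rfl⟩
  have hp := measurable_base_of_section hv
  refine measurable_of_forall_trivializationAt (E := E) hp _ fun x ↦ ?_
  set e := trivializationAt E (TangentSpace 𝓘(ℝ, E)) x
  have : ProperSpace E := FiniteDimensional.proper ℝ E
  have : IsContinuousRiemannianBundle E (fun x : M ↦ TangentSpace 𝓘(ℝ, E) x) := by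
    obtain ⟨g, hg, hg'⟩ := IsContMDiffRiemannianBundle.exists_contMDiff (IB := 𝓘(ℝ, E)) (n := ∞)
      (F := E) (E := fun x : M ↦ TangentSpace 𝓘(ℝ, E) x)
    exact ⟨g, hg.continuous, hg'⟩
  have hsymm : ∀ f : e.baseSet × E × E → E, Continuous f → Continuous fun z : e.baseSet × E × E ↦
      (⟨z.1, e.symm z.1 (f z)⟩ : TangentBundle 𝓘(ℝ, E) M) := by
    intro f hf
    exact e.continuousOn_symm.comp_continuous
      ((continuous_subtype_val.comp continuous_fst).prodMk hf) fun z ↦ ⟨z.1.2, mem_univ _⟩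
  have hG : Continuous fun z : e.baseSet × E × E ↦
      (inner ℝ (e.symm z.1 z.2.1) (e.symm z.1 z.2.2) : ℝ) :=
    Continuous.inner_bundle (F := E) (hsymm (fun z ↦ z.2.1) (by fun_prop))
      (hsymm (fun z ↦ z.2.2) (by fun_prop))
  have hF : Measurable fun a : p ⁻¹' e.baseSet ↦
      ((⟨p a, a.2⟩, (e ⟨p a, v a⟩).2, (e ⟨p a, w a⟩).2) : e.baseSet × E × E) :=
    (hp.comp measurable_subtype_coe).subtype_mk.prodMk
      ((measurable_trivialization_snd hv e).prodMk (measurable_trivialization_snd hw e))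
  have := hG.measurable.comp hF
  convert this using 1
  ext a
  simp [e.symm_apply_apply_mk a.2]

omit [SecondCountableTopology M] [MeasurableSpace M] [BorelSpace M] in
-- The inclusion of a fibre is inducing, so Borel sets of the fibre are traces of Borel sets of the
-- bundle.
theorem stronglyMeasurable_of_fiber {x : M} {v : α → TangentSpace 𝓘(ℝ, E) x}
    (hv : Measurable[inferInstance, borel (TangentBundle 𝓘(ℝ, E) M)]
      (fun a ↦ (⟨x, v a⟩ : TangentBundle 𝓘(ℝ, E) M))) : StronglyMeasurable v := by
  let _ : MeasurableSpace (TangentSpace 𝓘(ℝ, E) x) := borel _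
  have : BorelSpace (TangentSpace 𝓘(ℝ, E) x) := ⟨rfl⟩
  have : FiniteDimensional ℝ (TangentSpace 𝓘(ℝ, E) x) :=
    inferInstanceAs (FiniteDimensional ℝ E)
  have : ProperSpace (TangentSpace 𝓘(ℝ, E) x) := FiniteDimensional.proper ℝ _
  refine Measurable.stronglyMeasurable ?_
  have h := (FiberBundle.totalSpaceMk_isInducing E (TangentSpace 𝓘(ℝ, E) (M := M)) x).eq_induced
  have h2 : borel (TangentSpace 𝓘(ℝ, E) x) = (borel (TangentBundle 𝓘(ℝ, E) M)).comap
      (TotalSpace.mk x) := by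
    rw [← borel_comap, ← h]
  intro s hs
  obtain ⟨t, ht, rfl⟩ := (h2 ▸ hs : MeasurableSet[(borel (TangentBundle 𝓘(ℝ, E) M)).comap
      (TotalSpace.mk x)] s)
  exact hv ht

end Measurability

/-! ### Variance of a batch mean in a Hilbert space -/

section Variance

variable {H : Type*} [NormedAddCommGroup H] [InnerProductSpace ℝ H] [CompleteSpace H]
  {Ξ : Type*} [MeasurableSpace Ξ] {P : Measure Ξ} [IsProbabilityMeasure P]

theorem integral_norm_sub_integral_sq_le {g : Ξ → H} (hg : AEStronglyMeasurable g P) {C : ℝ}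
    (hC : ∀ᵐ ξ ∂P, ‖g ξ‖ ≤ C) : ∫ ξ, ‖g ξ - ∫ ξ', g ξ' ∂P‖ ^ 2 ∂P ≤ C ^ 2 := by
  have hgi : Integrable g P := Integrable.of_bound hg C hC
  have hsq : Integrable (fun ξ ↦ ‖g ξ‖ ^ 2) P :=
    (MemLp.of_bound hg C hC : MemLp g 2 P).integrable_norm_pow (by norm_num)
  set G := ∫ ξ', g ξ' ∂P with hG
  have h1 : ∀ ξ, ‖g ξ - G‖ ^ 2 = ‖g ξ‖ ^ 2 - 2 * inner ℝ G (g ξ) + ‖G‖ ^ 2 := fun ξ ↦ by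
    rw [norm_sub_sq_real, real_inner_comm]
  simp_rw [h1]
  rw [integral_add (by exact hsq.sub ((hgi.const_inner G).const_mul 2)) (integrable_const _),
    integral_sub hsq ((hgi.const_inner G).const_mul 2), integral_const_mul,
    integral_inner hgi, ← hG, real_inner_self_eq_norm_sq]
  have h2 : ∫ ξ, ‖g ξ‖ ^ 2 ∂P ≤ ∫ _, C ^ 2 ∂P := by
    refine integral_mono_ae hsq (integrable_const _) ?_
    filter_upwards [hC] with ξ h
    gcongr
  simp only [integral_const, probReal_univ, one_smul] at h2 ⊢
  nlinarith [sq_nonneg ‖G‖]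

theorem integral_inner_eval_eq_zero {K : ℕ} {h : Ξ → H} (hh : Integrable h P)
    (h0 : ∫ ξ, h ξ ∂P = 0) {i j : Fin K} (hij : i ≠ j) :
    ∫ ζ : Fin K → Ξ, (inner ℝ (h (ζ i)) (h (ζ j)) : ℝ) ∂(Measure.pi fun _ ↦ P) = 0 := by
  have hmp := fun l : Fin K ↦ measurePreserving_eval (fun _ : Fin K ↦ P) l
  have hI : IndepFun (fun ζ : Fin K → Ξ ↦ ζ i) (fun ζ ↦ ζ j) (Measure.pi fun _ ↦ P) :=
    (iIndepFun_pi (μ := fun _ : Fin K ↦ P) (X := fun _ ↦ id)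
      (fun _ ↦ aemeasurable_id)).indepFun hij
  have := hI.integral_bilin_comp_comp (f := h) (g := h) (measurable_pi_apply i).aemeasurable
    (measurable_pi_apply j).aemeasurable (by exact (hmp i).map_eq.symm ▸ hh)
    (by exact (hmp j).map_eq.symm ▸ hh) (innerSL ℝ)
  refine this.trans ?_
  have h1 : ∫ ζ : Fin K → Ξ, h (ζ i) ∂(Measure.pi fun _ ↦ P) = 0 := by
    rw [← h0]
    conv_rhs => rw [← (hmp i).map_eq]
    rw [integral_map (measurable_pi_apply i).aemeasurable
      (by rw [(hmp i).map_eq]; exact hh.1)]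
  rw [h1, map_zero, zero_apply]

/-- Independent centred vectors are orthogonal in mean. Expanding the square leaves `K` diagonal
terms, each at most `C²`, against the factor `1 / K²`. -/
theorem lintegral_norm_batch_sub_integral_sq_le {K : ℕ} (hK : 1 ≤ K) {g : Ξ → H}
    (hg : AEStronglyMeasurable g P) {C : ℝ} (hC : ∀ᵐ ξ ∂P, ‖g ξ‖ ≤ C) :
    ∫⁻ ζ : Fin K → Ξ, ENNReal.ofReal (‖(1 / (K : ℝ)) • ∑ i, g (ζ i) - ∫ ξ, g ξ ∂P‖ ^ 2)
      ∂(Measure.pi fun _ ↦ P) ≤ ENNReal.ofReal (C ^ 2 / K) := by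
  have hK0 : (0 : ℝ) < K := by exact_mod_cast hK
  have hgi : Integrable g P := Integrable.of_bound hg C hC
  set G := ∫ ξ, g ξ ∂P with hG
  let h : Ξ → H := fun ξ ↦ g ξ - G
  have hh : MemLp h 2 P := (MemLp.of_bound hg C hC).sub (memLp_const G)
  have h0 : ∫ ξ, h ξ ∂P = 0 := by
    rw [integral_sub hgi (integrable_const _)]
    simp [hG]
  have hmp := fun l : Fin K ↦ measurePreserving_eval (fun _ : Fin K ↦ P) l
  have hL : ∀ i, MemLp (fun ζ : Fin K → Ξ ↦ h (ζ i)) 2 (Measure.pi fun _ ↦ P) := fun i ↦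
    hh.comp_measurePreserving (hmp i)
  have hint : ∀ i j, Integrable (fun ζ : Fin K → Ξ ↦ (inner ℝ (h (ζ i)) (h (ζ j)) : ℝ))
      (Measure.pi fun _ ↦ P) := fun i j ↦ by
    refine Integrable.mono' (((hL i).integrable_norm_pow two_ne_zero).add
      ((hL j).integrable_norm_pow two_ne_zero)) ((hL i).1.inner (hL j).1) (.of_forall fun ζ ↦ ?_)
    refine (norm_inner_le_norm (𝕜 := ℝ) (h (ζ i)) (h (ζ j))).trans ?_
    simp only [Pi.add_apply]
    nlinarith [sq_nonneg (‖h (ζ i)‖ - ‖h (ζ j)‖), sq_nonneg (‖h (ζ i)‖ + ‖h (ζ j)‖)]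
  have hexp : ∀ ζ : Fin K → Ξ, ‖(1 / (K : ℝ)) • ∑ i, g (ζ i) - G‖ ^ 2 =
      (1 / (K : ℝ)) ^ 2 * ∑ i, ∑ j, inner ℝ (h (ζ i)) (h (ζ j)) := by
    intro ζ
    have : (1 / (K : ℝ)) • ∑ i, g (ζ i) - G = (1 / (K : ℝ)) • ∑ i, h (ζ i) := by
      simp only [h, Finset.sum_sub_distrib, smul_sub, Finset.sum_const, Finset.card_univ,
        Fintype.card_fin]
      rw [← Nat.cast_smul_eq_nsmul ℝ, smul_smul, one_div_mul_cancel hK0.ne', one_smul]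
    rw [this, norm_smul, mul_pow, Real.norm_eq_abs, sq_abs, ← real_inner_self_eq_norm_sq,
      sum_inner]
    simp_rw [inner_sum]
  simp_rw [hexp]
  rw [← ofReal_integral_eq_lintegral_ofReal]
  · refine ENNReal.ofReal_le_ofReal ?_
    rw [integral_const_mul, integral_finsetSum _ fun i _ ↦ integrable_finsetSum _ fun j _ ↦ hint i j]
    have hi : ∀ i : Fin K, ∫ ζ : Fin K → Ξ, (∑ j, inner ℝ (h (ζ i)) (h (ζ j)) : ℝ)
        ∂(Measure.pi fun _ ↦ P) ≤ C ^ 2 := by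
      intro i
      rw [integral_finsetSum _ fun j _ ↦ hint i j, Finset.sum_eq_single i
        (fun j _ hj ↦ integral_inner_eval_eq_zero (hh.integrable (by norm_num)) h0 hj.symm)
        (by simp)]
      simp_rw [real_inner_self_eq_norm_sq]
      refine le_trans (le_of_eq ?_) (integral_norm_sub_integral_sq_le hg hC)
      change _ = ∫ ξ, ‖h ξ‖ ^ 2 ∂P
      conv_rhs => rw [← (hmp i).map_eq]
      rw [integral_map (measurable_pi_apply i).aemeasurable
        (by rw [(hmp i).map_eq]; exact (hh.1.norm.pow 2))]
    calc _ ≤ (1 / (K : ℝ)) ^ 2 * ∑ _i : Fin K, C ^ 2 := by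
          gcongr with i
          exact hi i
      _ = C ^ 2 / K := by
          simp only [Finset.sum_const, Finset.card_univ, Fintype.card_fin, nsmul_eq_mul]
          field_simp
  · exact (integrable_finsetSum _ fun i _ ↦ integrable_finsetSum _ fun j _ ↦ hint i j).const_mul _
  · exact Filter.Eventually.of_forall fun ζ ↦ (sq_nonneg _).trans_eq (hexp ζ)

end Variance

/-! ### Error of the batch gradient at a random point -/

section BatchError

variable {E : Type*} [NormedAddCommGroup E] [NormedSpace ℝ E] [FiniteDimensional ℝ E]
  {M : Type*} [EMetricSpace M] [SecondCountableTopology M] [MeasurableSpace M] [BorelSpace M]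
  [ChartedSpace E M] [IsManifold 𝓘(ℝ, E) ∞ M]
  [RiemannianBundle (fun x : M ↦ TangentSpace 𝓘(ℝ, E) x)]
  {X : Set M} {Ξ : Type*} [MeasurableSpace Ξ] {P : Measure Ξ} [IsProbabilityMeasure P]
  {φ : M → Ξ → ℝ} {Φ : M → ℝ} {C : ℝ}

instance completeSpace_tangentSpace (x : M) : CompleteSpace (TangentSpace 𝓘(ℝ, E) x) :=
  have : FiniteDimensional ℝ (TangentSpace 𝓘(ℝ, E) x) :=
    inferInstanceAs (FiniteDimensional ℝ E)
  FiniteDimensional.complete ℝ (TangentSpace 𝓘(ℝ, E) x)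

omit [SecondCountableTopology M] [BorelSpace M] in
theorem stronglyMeasurable_grad
    (hφm : Measurable[inferInstance, borel (TangentBundle 𝓘(ℝ, E) M)]
      (fun p : X × Ξ ↦ (⟨p.1, grad E (fun z ↦ φ z p.2) p.1⟩ : TangentBundle 𝓘(ℝ, E) M)))
    {x : M} (hx : x ∈ X) : StronglyMeasurable fun ξ ↦ grad E (fun z ↦ φ z ξ) x :=
  stronglyMeasurable_of_fiber (hφm.comp (measurable_prodMk_left (x := (⟨x, hx⟩ : X))))

/-- Only the stochastic gradient is known to be a measurable section. Unbiasedness writes this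
pairing as the integral over a second sample of the pairing of two stochastic gradients. -/
theorem measurable_inner_grad
    [IsContMDiffRiemannianBundle 𝓘(ℝ, E) ∞ E (fun x : M ↦ TangentSpace 𝓘(ℝ, E) x)]
    (hφm : Measurable[inferInstance, borel (TangentBundle 𝓘(ℝ, E) M)]
      (fun p : X × Ξ ↦ (⟨p.1, grad E (fun z ↦ φ z p.2) p.1⟩ : TangentBundle 𝓘(ℝ, E) M)))
    (hunb : ∀ x ∈ X, ∫ ξ, grad E (fun z ↦ φ z ξ) x ∂P = grad E Φ x)
    (hC : ∀ x ∈ X, ∀ᵐ ξ ∂P, ‖grad E (fun z ↦ φ z ξ) x‖ ≤ C) :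
    Measurable fun p : X × Ξ ↦
      (inner ℝ (grad E Φ (p.1 : M)) (grad E (fun z ↦ φ z p.2) (p.1 : M)) : ℝ) := by
  have h1 : Measurable fun q : (X × Ξ) × Ξ ↦
      (inner ℝ (grad E (fun z ↦ φ z q.1.2) (q.1.1 : M))
        (grad E (fun z ↦ φ z q.2) (q.1.1 : M)) : ℝ) :=
    measurable_inner_section (hφm.comp measurable_fst)
      (hφm.comp (measurable_fst.fst.prodMk measurable_snd))
  convert (h1.stronglyMeasurable.integral_prod_right' (ν := P)).measurable using 2 with p
  dsimp only
  rw [integral_inner (𝕜 := ℝ) (Integrable.of_bound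
    (stronglyMeasurable_grad hφm p.1.2).aestronglyMeasurable C (hC _ p.1.2)), hunb _ p.1.2,
    real_inner_comm]

/-- The expansion involves scalar pairings only, whose measurability is available one by one. -/
theorem norm_smul_sum_sub_sq {H : Type*} [NormedAddCommGroup H] [InnerProductSpace ℝ H]
    {ι : Type*} [Fintype ι] (c : ℝ) (a : ι → H) (b : H) :
    ‖c • ∑ i, a i - b‖ ^ 2 = c ^ 2 * ∑ i, ∑ j, inner ℝ (a i) (a j) -
      2 * (c * ∑ i, inner ℝ b (a i)) + inner ℝ b b := by
  rw [norm_sub_sq_real, norm_smul, mul_pow, Real.norm_eq_abs, sq_abs,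
    ← real_inner_self_eq_norm_sq, sum_inner, real_inner_comm, inner_smul_right, inner_sum,
    ← real_inner_self_eq_norm_sq]
  simp_rw [inner_sum]

theorem measurable_norm_batchGrad_sub_sq
    [IsContMDiffRiemannianBundle 𝓘(ℝ, E) ∞ E (fun x : M ↦ TangentSpace 𝓘(ℝ, E) x)]
    (hφm : Measurable[inferInstance, borel (TangentBundle 𝓘(ℝ, E) M)]
      (fun p : X × Ξ ↦ (⟨p.1, grad E (fun z ↦ φ z p.2) p.1⟩ : TangentBundle 𝓘(ℝ, E) M)))
    (hunb : ∀ x ∈ X, ∫ ξ, grad E (fun z ↦ φ z ξ) x ∂P = grad E Φ x)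
    (hC : ∀ x ∈ X, ∀ᵐ ξ ∂P, ‖grad E (fun z ↦ φ z ξ) x‖ ≤ C) (K : ℕ) :
    Measurable fun p : X × (Fin K → Ξ) ↦
      ‖batchGrad E φ (p.1 : M) p.2 - grad E Φ (p.1 : M)‖ ^ 2 := by
  have hev : ∀ i, Measurable fun p : X × (Fin K → Ξ) ↦ (p.1, p.2 i) := fun i ↦
    measurable_fst.prodMk ((measurable_pi_apply i).comp measurable_snd)
  have h1 := measurable_inner_grad hφm hunb hC
  have h2 : Measurable fun x : X ↦ (inner ℝ (grad E Φ (x : M)) (grad E Φ (x : M)) : ℝ) := by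
    convert (h1.stronglyMeasurable.integral_prod_right' (ν := P)).measurable using 2 with x
    dsimp only
    rw [integral_inner (𝕜 := ℝ) (Integrable.of_bound
      (stronglyMeasurable_grad hφm x.2).aestronglyMeasurable C (hC _ x.2)), hunb _ x.2]
  have h3 : ∀ i j, Measurable fun p : X × (Fin K → Ξ) ↦
      (inner ℝ (grad E (fun z ↦ φ z (p.2 i)) (p.1 : M))
        (grad E (fun z ↦ φ z (p.2 j)) (p.1 : M)) : ℝ) := fun i j ↦
    measurable_inner_section (hφm.comp (hev i)) (hφm.comp (hev j))
  have h6 : ∀ i, Measurable fun p : X × (Fin K → Ξ) ↦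
      (inner ℝ (grad E Φ (p.1 : M)) (grad E (fun z ↦ φ z (p.2 i)) (p.1 : M)) : ℝ) :=
    fun i ↦ (h1.comp (hev i) :)
  have h7 : Measurable fun p : X × (Fin K → Ξ) ↦ ∑ i, ∑ j,
      (inner ℝ (grad E (fun z ↦ φ z (p.2 i)) (p.1 : M))
        (grad E (fun z ↦ φ z (p.2 j)) (p.1 : M)) : ℝ) :=
    Finset.measurable_fun_sum _ fun i _ ↦ Finset.measurable_fun_sum _ fun j _ ↦ h3 i j
  have h8 : Measurable fun p : X × (Fin K → Ξ) ↦ ∑ i,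
      (inner ℝ (grad E Φ (p.1 : M)) (grad E (fun z ↦ φ z (p.2 i)) (p.1 : M)) : ℝ) :=
    Finset.measurable_fun_sum _ fun i _ ↦ h6 i
  have h9 : Measurable fun p : X × (Fin K → Ξ) ↦
      (inner ℝ (grad E Φ (p.1 : M)) (grad E Φ (p.1 : M)) : ℝ) := h2.comp measurable_fst
  have h10 := ((h7.const_mul ((1 / (K : ℝ)) ^ 2)).sub
    ((h8.const_mul (1 / (K : ℝ))).const_mul 2)).add h9
  refine (congrArg Measurable (funext fun p ↦ ?_)).mpr h10
  exact norm_smul_sum_sub_sq _ _ _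

/-- Independence makes the joint law of point and batch a product, so Tonelli reduces the bound to a
fixed point. Working with `∫⁻` postpones integrability, which then follows from the bound. -/
theorem lintegral_batchGrad_error_le
    [IsContMDiffRiemannianBundle 𝓘(ℝ, E) ∞ E (fun x : M ↦ TangentSpace 𝓘(ℝ, E) x)]
    (hφm : Measurable[inferInstance, borel (TangentBundle 𝓘(ℝ, E) M)]
      (fun p : X × Ξ ↦ (⟨p.1, grad E (fun z ↦ φ z p.2) p.1⟩ : TangentBundle 𝓘(ℝ, E) M)))
    (hunb : ∀ x ∈ X, ∫ ξ, grad E (fun z ↦ φ z ξ) x ∂P = grad E Φ x)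
    (hC : ∀ x ∈ X, ∀ᵐ ξ ∂P, ‖grad E (fun z ↦ φ z ξ) x‖ ≤ C) {K : ℕ} (hK : 1 ≤ K)
    {Ω : Type*} [MeasurableSpace Ω] {μ : Measure Ω} [IsProbabilityMeasure μ]
    {x : Ω → X} {ζ : Fin K → Ω → Ξ} (hx : Measurable x) (hζ : ∀ i, Measurable (ζ i))
    (hlaw : ∀ i, μ.map (ζ i) = P) (hind : iIndepFun ζ μ)
    (hxζ : IndepFun x (fun w i ↦ ζ i w) μ) :
    ∫⁻ w, ENNReal.ofReal
      (‖(batchGrad E φ (x w : M) fun i ↦ ζ i w) - grad E Φ (x w : M)‖ ^ 2) ∂μ ≤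
        ENNReal.ofReal (C ^ 2 / K) := by
  have hζ' : Measurable fun w i ↦ ζ i w := measurable_pi_lambda _ hζ
  have hm := (measurable_norm_batchGrad_sub_sq hφm hunb hC K).ennreal_ofReal
  have hmap := (indepFun_iff_map_prod_eq_prod_map_map hx.aemeasurable hζ'.aemeasurable).1 hxζ
  rw [(iIndepFun_iff_map_fun_eq_pi_map fun i ↦ (hζ i).aemeasurable).1 hind] at hmap
  simp_rw [hlaw] at hmap
  have := lintegral_map (μ := μ) hm (hx.prodMk hζ')
  refine this.symm.trans_le ?_
  rw [hmap, lintegral_prod _ hm.aemeasurable]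
  have : IsProbabilityMeasure (μ.map x) := Measure.isProbabilityMeasure_map hx.aemeasurable
  calc _ ≤ ∫⁻ _, ENNReal.ofReal (C ^ 2 / K) ∂(μ.map x) := by
        refine lintegral_mono fun z ↦ ?_
        have := lintegral_norm_batch_sub_integral_sq_le hK
          (stronglyMeasurable_grad hφm z.2).aestronglyMeasurable (hC _ z.2)
        rwa [hunb _ z.2] at this
    _ = _ := by simp

end BatchError

/-! ### The deterministic descent inequality -/

section Step

variable {E : Type*} [NormedAddCommGroup E] [NormedSpace ℝ E] [FiniteDimensional ℝ E]
  {M : Type*} [EMetricSpace M] [ChartedSpace E M] [IsManifold 𝓘(ℝ, E) ∞ M]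
  [RiemannianBundle (fun x : M ↦ TangentSpace 𝓘(ℝ, E) x)] [IsRiemannianManifold 𝓘(ℝ, E) M]
  {X : Set M} {Φ : M → ℝ}

theorem frankWolfe_step (hX : GeodesicallyConvex E X) {L D : ℝ}
    (hL : LSmoothOn E L X Φ) (hconv : GConvexOn E X Φ)
    (hD : ∀ x ∈ X, ∀ y ∈ X, gdist x y ≤ D)
    {x y z : M} (hx : x ∈ X) (hy : y ∈ X) (hz : z ∈ X) {v : TangentSpace 𝓘(ℝ, E) x}
    (hmin : IsMinOn (fun u ↦ inner ℝ v (invExp E X x u)) X y) {η : ℝ} (hη : η ∈ Icc (0 : ℝ) 1) :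
    η * (Φ x - Φ z) ≤ Φ x - Φ (geodesicMap E X x y η) + D * ‖v - grad E Φ x‖ ^ 2 +
      (D + |L| / 2 * D ^ 2) * η ^ 2 := by
  have hg0 : ∀ a b : M, 0 ≤ gdist a b := fun _ _ ↦ ENNReal.toReal_nonneg
  have hD0 : 0 ≤ D := (hg0 x x).trans (hD x hx x hx)
  have h1 := hL.2 x hx _ ((geodesicMap_spec (E := E) hX hx hy).2 hη)
  rw [invExp_geodesicMap hX hx hy hη, inner_smul_right, gdist_geodesicMap hX hx hy hη] at h1
  have h2 := hconv x hx z hz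
  have h3 : inner ℝ v (invExp E X x y) ≤ inner ℝ v (invExp E X x z) := hmin hz
  set r := ‖v - grad E Φ x‖ with hr
  have h4 : inner ℝ (v - grad E Φ x) (invExp E X x z - invExp E X x y) ≤ r * (2 * D) := by
    refine (real_inner_le_norm _ _).trans ?_
    gcongr
    refine (norm_sub_le _ _).trans ?_
    rw [norm_invExp hX hx hz, norm_invExp hX hx hy]
    linarith [hD x hx z hz, hD x hx y hy]
  simp only [inner_sub_left, inner_sub_right] at h4
  -- Replacing `grad Φ x` by `v` and back costs the pairing of `v - grad Φ x` with the difference of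
  -- the two directions, bounded in `h4`.
  have h5 : inner ℝ (grad E Φ x) (invExp E X x y) ≤ Φ z - Φ x + r * (2 * D) := by linarith
  have h6 := mul_le_mul_of_nonneg_left h5 hη.1
  -- `L` has no sign assumption, hence `|L|`.
  have h7 : L / 2 * (η * gdist x y) ^ 2 ≤ |L| / 2 * D ^ 2 * η ^ 2 := by
    rw [mul_pow]
    calc L / 2 * (η ^ 2 * gdist x y ^ 2) ≤ |L| / 2 * (η ^ 2 * D ^ 2) := by
          gcongr
          · exact le_abs_self L
          · exact hg0 x y
          · exact hD x hx y hy
      _ = _ := by ring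
  -- The hint is `2 D η r ≤ D η² + D r²`, which explains the summand `D` in the coefficient of `η²`.
  nlinarith [mul_nonneg hD0 (sq_nonneg (η - r))]

end Step

/-! ### Averaging over the random output index -/

section RandomIndex

theorem integral_uniform_index {Ω : Type*} {m mΩ : MeasurableSpace Ω} {μ : Measure Ω} {K : ℕ}
    {κ : Ω → Fin K} {f : Fin K → Ω → ℝ} (hm : m ≤ mΩ) (hκ : Measurable κ)
    (hunif : ∀ j, μ (κ ⁻¹' {j}) = (K : ENNReal)⁻¹)
    (hind : Indep (MeasurableSpace.comap κ ⊤) m μ) (hf : ∀ j, Measurable[m] (f j))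
    (hfi : ∀ j, Integrable (f j) μ) :
    Integrable (fun w ↦ f (κ w) w) μ ∧
      ∫ w, f (κ w) w ∂μ = (K : ℝ)⁻¹ * ∑ j, ∫ w, f j w ∂μ := by
  have hs : ∀ j, MeasurableSet (κ ⁻¹' {j}) := fun j ↦ hκ (measurableSet_singleton j)
  have hexp : (fun w ↦ f (κ w) w) = fun w ↦ ∑ j, (κ ⁻¹' {j}).indicator (f j) w := by
    ext w
    rw [Finset.sum_eq_single (κ w) (fun j _ hj ↦ indicator_of_notMem (fun h ↦ hj h.symm) _)
      (by simp), indicator_of_mem (by simp)]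
  have hi : ∀ j, Integrable (fun w ↦ (κ ⁻¹' {j}).indicator (f j) w) μ := fun j ↦
    (hfi j).indicator (hs j)
  rw [hexp]
  refine ⟨integrable_finsetSum _ fun j _ ↦ hi j, ?_⟩
  rw [integral_finsetSum _ fun j _ ↦ hi j, Finset.mul_sum]
  refine Finset.sum_congr rfl fun j _ ↦ ?_
  have hj : MeasurableSet[MeasurableSpace.comap κ ⊤] (κ ⁻¹' {j}) := ⟨{j}, trivial, rfl⟩
  have := Indep.setIntegral_eq_smul (X := f j) (f := id)
    (measurable_iff_comap_le.1 hκ)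
    (indep_of_indep_of_le_right hind (hf j).comap_le) ((hf j).mono hm le_rfl).aemeasurable hj
    aestronglyMeasurable_id
  rw [integral_indicator (hs j)]
  refine this.trans ?_
  simp [measureReal_def, hunif]

end RandomIndex

/-! ### Integrability of the objective along the run -/

section ContinuousOn

variable {M : Type*} [EMetricSpace M] [MeasurableSpace M] [BorelSpace M] {X : Set M} {Φ : M → ℝ}
  {Ω : Type*}

theorem measurable_comp_of_continuousOn {m : MeasurableSpace Ω} {u : Ω → M} (hu : Measurable[m] u)
    (huX : ∀ w, u w ∈ X) (hΦ : ContinuousOn Φ X) : Measurable[m] fun w ↦ Φ (u w) :=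
  (continuousOn_iff_continuous_domRestrict.1 hΦ).measurable.comp (hu.subtype_mk (h := huX))

theorem integrable_comp_of_continuousOn [MeasurableSpace Ω] {μ : Measure Ω}
    [IsFiniteMeasure μ] {u : Ω → M} (hu : Measurable u)
    (huX : ∀ w, u w ∈ X) (hXc : IsCompact X) (hΦ : ContinuousOn Φ X) :
    Integrable (fun w ↦ Φ (u w)) μ := by
  obtain ⟨B, hB⟩ := hXc.exists_bound_of_continuousOn hΦ
  exact Integrable.of_bound (measurable_comp_of_continuousOn hu huX hΦ).aestronglyMeasurable B
    (.of_forall fun w ↦ hB _ (huX w))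

end ContinuousOn

theorem LSmoothOn.continuousOn {E : Type*} [NormedAddCommGroup E] [NormedSpace ℝ E]
    [FiniteDimensional ℝ E] {M : Type*} [EMetricSpace M] [ChartedSpace E M]
    [RiemannianBundle (fun x : M ↦ TangentSpace 𝓘(ℝ, E) x)] {X : Set M} {Φ : M → ℝ} {L : ℝ}
    (hL : LSmoothOn E L X Φ) : ContinuousOn Φ X :=
  fun x hx ↦ (hL.1 x hx).continuousAt.continuousWithinAt

/-! ### Expected progress of a run -/

section Run

variable {E : Type*} [NormedAddCommGroup E] [NormedSpace ℝ E] [FiniteDimensional ℝ E]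
  {M : Type*} [EMetricSpace M] [SecondCountableTopology M] [MeasurableSpace M] [BorelSpace M]
  [ChartedSpace E M] [IsManifold 𝓘(ℝ, E) ∞ M]
  [RiemannianBundle (fun x : M ↦ TangentSpace 𝓘(ℝ, E) x)]
  {X : Set M} {Ξ : Type*} [MeasurableSpace Ξ] {P : Measure Ξ} [IsProbabilityMeasure P]
  {φ : M → Ξ → ℝ} {Φ : M → ℝ} {C : ℝ} {x₀ : M} {K : ℕ} {η : ℕ → ℝ}
  {Ω : Type*} [mΩ : MeasurableSpace Ω] {μ : Measure Ω} [IsProbabilityMeasure μ]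
  {ℱ : Filtration ℕ mΩ} {ξ : ℕ → Fin K → Ω → Ξ} {x y : ℕ → Ω → M} {κ : Ω → Fin K}

omit [SecondCountableTopology M] [BorelSpace M] [IsManifold 𝓘(ℝ, E) ∞ M] [IsProbabilityMeasure P]
  [IsProbabilityMeasure μ] in
theorem IsSRFWRun.mem (hrun : IsSRFWRun E X φ P x₀ K (fun _ ↦ K) η μ ℱ ξ x y κ)
    (hX : GeodesicallyConvex E X) (hx₀ : x₀ ∈ X) (hη : ∀ k, η k ∈ Icc (0 : ℝ) 1) :
    ∀ k ≤ K, ∀ w, x k w ∈ X := by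
  intro k
  induction k with
  | zero => intro _ w; rwa [hrun.init w]
  | succ k ih =>
    intro hk w
    rw [hrun.step k hk w]
    exact (geodesicMap_spec (E := E) hX (ih (Nat.le_of_succ_le hk) w)
      (hrun.oracle_mem k hk w)).2 (hη k)

theorem IsSRFWRun.integral_batchGrad_error_le
    [IsContMDiffRiemannianBundle 𝓘(ℝ, E) ∞ E (fun x : M ↦ TangentSpace 𝓘(ℝ, E) x)]
    (hrun : IsSRFWRun E X φ P x₀ K (fun _ ↦ K) η μ ℱ ξ x y κ)
    (hφm : Measurable[inferInstance, borel (TangentBundle 𝓘(ℝ, E) M)]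
      (fun p : X × Ξ ↦ (⟨p.1, grad E (fun z ↦ φ z p.2) p.1⟩ : TangentBundle 𝓘(ℝ, E) M)))
    (hunb : ∀ x ∈ X, ∫ ξ, grad E (fun z ↦ φ z ξ) x ∂P = grad E Φ x)
    (hC : ∀ x ∈ X, ∀ᵐ ξ ∂P, ‖grad E (fun z ↦ φ z ξ) x‖ ≤ C)
    (hxX : ∀ k ≤ K, ∀ w, x k w ∈ X) {k : ℕ} (hk : k < K) :
    Integrable (fun w ↦ ‖(batchGrad E φ (x k w) fun i ↦ ξ k i w) - grad E Φ (x k w)‖ ^ 2) μ ∧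
      ∫ w, ‖(batchGrad E φ (x k w) fun i ↦ ξ k i w) - grad E Φ (x k w)‖ ^ 2 ∂μ ≤ C ^ 2 / K := by
  have hK : 1 ≤ K := Nat.one_le_of_lt hk
  have hu : Measurable[ℱ k] fun w ↦ (⟨x k w, hxX k hk.le w⟩ : X) :=
    (hrun.adapted_x k hk.le).subtype_mk
  have hξ : ∀ i, Measurable (ξ k i) := fun i ↦
    (hrun.adapted_sample k hk i).mono (ℱ.le _) le_rfl
  have hind : IndepFun (fun w ↦ (⟨x k w, hxX k hk.le w⟩ : X)) (fun w i ↦ ξ k i w) μ := by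
    rw [IndepFun_iff_Indep]
    exact (indep_of_indep_of_le_right (hrun.indep_history k hk) hu.comap_le).symm
  have h1 := lintegral_batchGrad_error_le hφm hunb hC hK (hu.mono (ℱ.le k) le_rfl) hξ
    (hrun.law_sample k hk) (hrun.indep_sample k hk) hind
  have hm : Measurable fun w ↦
      ‖(batchGrad E φ (x k w) fun i ↦ ξ k i w) - grad E Φ (x k w)‖ ^ 2 :=
    ((measurable_norm_batchGrad_sub_sq hφm hunb hC K).comp
      ((hu.mono (ℱ.le k) le_rfl).prodMk (measurable_pi_lambda _ hξ)) :)
  have h0 : 0 ≤ᵐ[μ] fun w ↦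
      ‖(batchGrad E φ (x k w) fun i ↦ ξ k i w) - grad E Φ (x k w)‖ ^ 2 :=
    .of_forall fun w ↦ sq_nonneg _
  refine ⟨(lintegral_ofReal_ne_top_iff_integrable hm.aestronglyMeasurable h0).1
    (h1.trans_lt ENNReal.ofReal_lt_top).ne, ?_⟩
  rw [integral_eq_lintegral_of_nonneg_ae h0 hm.aestronglyMeasurable]
  exact ENNReal.toReal_le_of_le_ofReal (by positivity) h1

theorem IsSRFWRun.integral_step_le
    [IsContMDiffRiemannianBundle 𝓘(ℝ, E) ∞ E (fun x : M ↦ TangentSpace 𝓘(ℝ, E) x)]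
    [IsRiemannianManifold 𝓘(ℝ, E) M]
    (hrun : IsSRFWRun E X φ P x₀ K (fun _ ↦ K) η μ ℱ ξ x y κ)
    (hXc : IsCompact X) (hX : GeodesicallyConvex E X)
    (hφm : Measurable[inferInstance, borel (TangentBundle 𝓘(ℝ, E) M)]
      (fun p : X × Ξ ↦ (⟨p.1, grad E (fun z ↦ φ z p.2) p.1⟩ : TangentBundle 𝓘(ℝ, E) M)))
    (hunb : ∀ x ∈ X, ∫ ξ, grad E (fun z ↦ φ z ξ) x ∂P = grad E Φ x)
    (hC : ∀ x ∈ X, ∀ᵐ ξ ∂P, ‖grad E (fun z ↦ φ z ξ) x‖ ≤ C)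
    {L D : ℝ} (hL : LSmoothOn E L X Φ) (hconv : GConvexOn E X Φ)
    (hD0 : 0 ≤ D) (hD : ∀ x ∈ X, ∀ y ∈ X, gdist x y ≤ D) {z : M} (hz : z ∈ X)
    (hη : ∀ k, η k ∈ Icc (0 : ℝ) 1) (hxX : ∀ k ≤ K, ∀ w, x k w ∈ X) {k : ℕ} (hk : k < K) :
    η k * ∫ w, (Φ (x k w) - Φ z) ∂μ ≤ ∫ w, Φ (x k w) ∂μ - ∫ w, Φ (x (k + 1) w) ∂μ +
      D * (C ^ 2 / K) + (D + |L| / 2 * D ^ 2) * η k ^ 2 := by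
  have hi : ∀ k ≤ K, Integrable (fun w ↦ Φ (x k w)) μ := fun k hk ↦
    integrable_comp_of_continuousOn ((hrun.adapted_x k hk).mono (ℱ.le k) le_rfl) (hxX k hk) hXc
      hL.continuousOn
  obtain ⟨hr, hr'⟩ := hrun.integral_batchGrad_error_le hφm hunb hC hxX hk
  rw [← integral_const_mul]
  have h1 := integral_mono (((hi k hk.le).sub (integrable_const (Φ z))).const_mul (η k))
    ((((hi k hk.le).sub (hi (k + 1) hk)).add (hr.const_mul D)).add
      (integrable_const ((D + |L| / 2 * D ^ 2) * η k ^ 2))) (fun w ↦ by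
      have := frankWolfe_step hX hL hconv hD (hxX k hk.le w) (hrun.oracle_mem k hk w) hz
        (hrun.oracle_min k hk w) (hη k)
      rwa [← hrun.step k hk w] at this)
  refine h1.trans ?_
  simp only [Pi.add_apply, Pi.sub_apply]
  rw [integral_add (by exact ((hi k hk.le).sub (hi (k + 1) hk)).add (hr.const_mul D))
      (integrable_const _),
    integral_add (by exact (hi k hk.le).sub (hi (k + 1) hk)) (hr.const_mul D),
    integral_sub (hi k hk.le) (hi (k + 1) hk), integral_const_mul]
  simp only [integral_const, probReal_univ, one_smul]
  gcongr

end Run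

end RiemannianFW

/-! ### The convergence rate -/

theorem mainTheorem5
    {E : Type*} [NormedAddCommGroup E] [NormedSpace ℝ E] [FiniteDimensional ℝ E]
    {M : Type*} [EMetricSpace M] [SecondCountableTopology M] [MeasurableSpace M] [BorelSpace M]
    [ChartedSpace E M] [IsManifold 𝓘(ℝ, E) ∞ M]
    [RiemannianBundle (fun x : M ↦ TangentSpace 𝓘(ℝ, E) x)]
    [IsContMDiffRiemannianBundle 𝓘(ℝ, E) ∞ E (fun x : M ↦ TangentSpace 𝓘(ℝ, E) x)]
    [IsRiemannianManifold 𝓘(ℝ, E) M]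
    (X : Set M) (hXc : IsCompact X) (hXg : RiemannianFW.GeodesicallyConvex E X)
    {Ξ : Type*} [MeasurableSpace Ξ] (P : Measure Ξ) [IsProbabilityMeasure P]
    (φ : M → Ξ → ℝ) (Φ : M → ℝ)
    (hφi : ∀ x, Integrable (φ x) P) (hΦ : ∀ x, Φ x = ∫ ξ, φ x ξ ∂P)
    (hφd : ∀ x ∈ X, ∀ᵐ ξ ∂P, MDifferentiableAt 𝓘(ℝ, E) 𝓘(ℝ, ℝ) (fun z ↦ φ z ξ) x)
    (hφm : Measurable[inferInstance, borel (TangentBundle 𝓘(ℝ, E) M)]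
      (fun p : X × Ξ ↦ (⟨p.1, RiemannianFW.grad E (fun z ↦ φ z p.2) p.1⟩ :
        TangentBundle 𝓘(ℝ, E) M)))
    (hunb : ∀ x ∈ X, ∫ ξ, RiemannianFW.grad E (fun z ↦ φ z ξ) x ∂P = RiemannianFW.grad E Φ x)
    (C : ℝ) (hC : ∀ x ∈ X, ∀ᵐ ξ ∂P, ‖RiemannianFW.grad E (fun z ↦ φ z ξ) x‖ ≤ C)
    (L : ℝ) (hL : RiemannianFW.LSmoothOn E L X Φ)
    (hconv : RiemannianFW.GConvexOn E X Φ)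
    (xstar : M) (hstar : xstar ∈ X) (hmin : IsMinOn Φ X xstar)
    (x₀ : M) (hx₀ : x₀ ∈ X) :
    ∃ A : ℝ, ∀ K : ℕ, 1 ≤ K →
      ∀ {Ω : Type*} [mΩ : MeasurableSpace Ω] (μ : Measure Ω) [IsProbabilityMeasure μ]
        (ℱ : Filtration ℕ mΩ) (ξ : ℕ → Fin K → Ω → Ξ) (x y : ℕ → Ω → M) (κ : Ω → Fin K),
        RiemannianFW.IsSRFWRun E X φ P x₀ K (fun _ ↦ K) (fun _ ↦ 1 / √(K : ℝ)) μ ℱ ξ x y κ →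
          Integrable (fun w ↦ Φ (x (κ w) w) - Φ xstar) μ ∧
          0 ≤ ∫ w, (Φ (x (κ w) w) - Φ xstar) ∂μ ∧
          ∫ w, (Φ (x (κ w) w) - Φ xstar) ∂μ ≤ A / √(K : ℝ) := by
  obtain ⟨D, hD0, hD⟩ := RiemannianFW.exists_gdist_le (E := E) hXc hXg
  -- The three summands are the telescoped decrease, the total batch error and the total `η²` error.
  refine ⟨Φ x₀ - Φ xstar + D * C ^ 2 + (D + |L| / 2 * D ^ 2), ?_⟩
  intro K hK Ω mΩ μ _ ℱ ξ x y κ hrun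
  have hK0 : (0 : ℝ) < K := by exact_mod_cast hK
  have hsK : 0 < √(K : ℝ) := Real.sqrt_pos.2 hK0
  have hη : ∀ _ : ℕ, 1 / √(K : ℝ) ∈ Icc (0 : ℝ) 1 := fun _ ↦
    ⟨by positivity, (div_le_one hsK).2 (Real.one_le_sqrt.2 (by exact_mod_cast hK))⟩
  have hxX := hrun.mem hXg hx₀ hη
  have hi : ∀ k ≤ K, Integrable (fun w ↦ Φ (x k w)) μ := fun k hk ↦
    RiemannianFW.integrable_comp_of_continuousOn ((hrun.adapted_x k hk).mono (ℱ.le k) le_rfl)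
      (hxX k hk) hXc hL.continuousOn
  -- The index is independent of `ℱ K`, so each gap is regarded as `ℱ K`-measurable.
  obtain ⟨h1, h2⟩ := RiemannianFW.integral_uniform_index
    (f := fun (j : Fin K) w ↦ Φ (x j w) - Φ xstar) (ℱ.le K) hrun.measurable_index
    hrun.uniform_index hrun.indep_index (fun j ↦ Measurable.sub_const
      ((RiemannianFW.measurable_comp_of_continuousOn (hrun.adapted_x j j.2.le) (hxX j j.2.le)
        hL.continuousOn).mono (ℱ.mono j.2.le) le_rfl) _)
    (fun j ↦ (hi j j.2.le).sub (integrable_const _))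
  refine ⟨h1, integral_nonneg fun w ↦ sub_nonneg.2 (hmin (hxX _ (κ w).2.le w)), ?_⟩
  rw [h2, Fin.sum_univ_eq_sum_range (fun k ↦ ∫ w, (Φ (x k w) - Φ xstar) ∂μ) K]
  have h3 : 1 / √(K : ℝ) * ∑ k ∈ Finset.range K, ∫ w, (Φ (x k w) - Φ xstar) ∂μ ≤
      ∑ k ∈ Finset.range K, (∫ w, Φ (x k w) ∂μ - ∫ w, Φ (x (k + 1) w) ∂μ +
        D * (C ^ 2 / K) + (D + |L| / 2 * D ^ 2) * (1 / √(K : ℝ)) ^ 2) := by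
    rw [Finset.mul_sum]
    exact Finset.sum_le_sum fun k hk ↦ hrun.integral_step_le hXc hXg hφm hunb hC hL hconv hD0 hD
      hstar hη hxX (Finset.mem_range.1 hk)
  rw [Finset.sum_add_distrib, Finset.sum_add_distrib, Finset.sum_range_sub', Finset.sum_const,
    Finset.sum_const, Finset.card_range, nsmul_eq_mul, nsmul_eq_mul, div_pow, Real.sq_sqrt hK0.le]
    at h3
  have h4 : ∫ w, Φ (x 0 w) ∂μ = Φ x₀ := by simp [hrun.init]
  have h5 : Φ xstar ≤ ∫ w, Φ (x K w) ∂μ := by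
    have := integral_mono (integrable_const (Φ xstar)) (hi K le_rfl)
      (fun w ↦ hmin (hxX K le_rfl w))
    simpa using this
  have h6 : (K : ℝ) * (D * (C ^ 2 / K)) = D * C ^ 2 := by field_simp
  have h7 : (K : ℝ) * ((D + |L| / 2 * D ^ 2) * (1 ^ 2 / K)) = D + |L| / 2 * D ^ 2 := by
    field_simp
  rw [h4, h6, h7] at h3
  -- One factor is the step size in `h3`; the other is the rate.
  have h8 : (K : ℝ)⁻¹ = 1 / √(K : ℝ) * (1 / √(K : ℝ)) := by
    rw [div_mul_div_comm, one_mul, Real.mul_self_sqrt hK0.le, one_div]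
  have h9 := mul_le_mul_of_nonneg_left (h3.trans (show _ ≤
    Φ x₀ - Φ xstar + D * C ^ 2 + (D + |L| / 2 * D ^ 2) by linarith)) (hη 0).1
  rwa [← mul_assoc, ← h8, one_div_mul_eq_div] at h9
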